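/- Let $n\ge 1$. For a real $n\times n$ matrix $X$ let $|X|$ and $\operatorname{sign}(X)$ denote the entrywise absolute value and the entrywise sign (with values in $\{-1,0,1\}$), and let $\mathbf 1_n$ be the all-ones vector. Let $\mathcal S^{+}_{\mathrm{s\text{-}symm}}$ be the set of $X\in\mathbb R^{n\times n}$ with $\operatorname{sign}(X)=\operatorname{sign}(X)^{\top}$ and $X_{ii}>0$ for all $i$, and let $$\mathcal S^{+}_{\mathrm{rs\text{-}symm}}=\{X\in\mathcal S^{+}_{\mathrm{s\text{-}symm}} : \operatorname{diag}(\gamma)X=(\operatorname{diag}(\gamma)X)^{\top}\text{ for some }\gamma\in\mathbb R^n\text{ with all }\gamma_i>0\}.$$ For $X\in\mathbb R^{n\times n}$ without zero rows put $f(X)=\operatorname{diag}(|X|\mathbf 1_n)^{-1}XX$. The influence-based model is the system $X(t+1)=f(X(t))$, $t=0,1,2,\dots$, with $X(0)\in\mathcal S^{+}_{\mathrm{rs\text{-}symm}}$. Let $\mathcal Q$ be the set of all matrices in $\mathcal S^{+}_{\mathrm{rs\text{-}symm}}$ of the form $PYP^{\top}$, where $P$ is a permutation matrix and $Y$ is a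 block diagonal matrix, each of whose blocks is of the form $\operatorname{sign}(w)w^{\top}$ for a real vector $w$ with no zero entry. Thus the rank-one elements of $\mathcal Q$ are the matrices $\operatorname{sign}(w)w^{\top}$ with $w\in\mathbb R^n$ having no zero entry. The network $G(X)$ with weighted adjacency matrix $X$ satisfies social balance if $X_{ii}>0$ for all $i$ and $\operatorname{sign}(X_{ij})\operatorname{sign}(X_{jk})\operatorname{sign}(X_{ki})=1$ for all $i,j,k$. The following statements hold. (i) Every $X^*\in\mathcal Q$ of rank one is a locally stable fixed point of $f$: $f(X^*)=X^*$, and for every $\varepsilon>0$ there is $\delta>0$ such that for every $X_0\in\mathbb R^{n\times n}$ with $\max_{i,j}|(X_0)_{ij}-X^*_{ij}|<\delta$ the iterates $X(0)=X_0$, $X(t+1)=f(X(t))$ are well defined (no $X(t)$ has a zero row) and satisfy $\max_{i,j}|X_{ij}(t)-X^*_{ij}|<\varepsilon$ for all $t\ge 0$. (ii) For every $X(0)\in\mathcal S^{+}_{\mathrm{rs\text{-}symm}}$, with $X(t)$ the solution of the influence-based model, the following three statements are equivalent: (a) $X(t)$ satisfies the non-vanishing appraisal condition $\liminf_{t\to\infty}\min_{i,j}|X_{ij}(t)|>0$;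 (b) there exists $t_0\ge 0$ such that $G(X(t))$ satisfies social balance for all $t\ge t_0$; (c) there exists $X^*\in\mathcal Q$ of rank one such that $\lim_{t\to\infty}X(t)=X^*$. -/

import Mathlib

open Matrix Filter Topology

namespace SocialBalance

noncomputable section

/-- Real `n × n` (appraisal) matrices none of whose rows is zero. -/
def nzRow (n : ℕ) : Set (Matrix (Fin n) (Fin n) ℝ) :=
  {X | ∀ i, X.row i ≠ 0}

/-- Sign-symmetric matrices with positive diagonal. -/
def signSymm (n : ℕ) : Set (Matrix (Fin n) (Fin n) ℝ) :=
  {X | X.map Real.sign = (X.map Real.sign)ᵀ ∧ ∀ i, 0 < X i i}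

/-- Sign-symmetric matrices with positive diagonal that become symmetric after
multiplying the rows by suitable positive numbers. -/
def rowScaledSignSymm (n : ℕ) : Set (Matrix (Fin n) (Fin n) ℝ) :=
  {X | X ∈ signSymm n ∧
    ∃ γ : Fin n → ℝ, (∀ i, 0 < γ i) ∧ diagonal γ * X = (diagonal γ * X)ᵀ}

/-- The map of the influence-based model, `X ↦ diag(|X| 1)⁻¹ X X`. The inverse is a genuine one
when `X ∈ nzRow n`. -/
def ibmMap {n : ℕ} (X : Matrix (Fin n) (Fin n) ℝ) : Matrix (Fin n) (Fin n) ℝ :=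
  (diagonal (X.map (fun x => |x|) *ᵥ 1))⁻¹ * X * X

/-- Solutions `X(0), X(1), …` of the influence-based model, with the initial appraisal matrix
in the row-scaled sign-symmetric class. -/
structure IsIbMSolution {n : ℕ} (X : ℕ → Matrix (Fin n) (Fin n) ℝ) : Prop where
  init : X 0 ∈ rowScaledSignSymm n
  step : ∀ t, X (t + 1) = ibmMap (X t)

/-- The appraisal network with adjacency matrix `X` satisfies social balance. -/
structure IsBalanced {n : ℕ} (X : Matrix (Fin n) (Fin n) ℝ) : Prop where
  diag_pos : ∀ i, 0 < X i i
  triad : ∀ i j k, Real.sign (X i j) * Real.sign (X j k) * Real.sign (X k i) = 1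

/-- `liminf_{t → ∞} min_{i,j} |X_{ij}(t)| > 0`. The minimum and the lower limit are taken in the
extended reals, where both always exist. -/
def NonVanishing {n : ℕ} (X : ℕ → Matrix (Fin n) (Fin n) ℝ) : Prop :=
  (0 : EReal) < liminf (fun t => ⨅ i, ⨅ j, ((|X t i j| : ℝ) : EReal)) atTop

/-- The block diagonal `n × n` matrix whose diagonal blocks, in this order, are
`sign(w_k) w_kᵀ` with `w_k ∈ ℝ^{m_k}`, `k = 1, …, K`, where `m_1 + … + m_K = n`. -/
def signBlockMatrix {n K : ℕ} (m : Fin K → ℕ) (hm : ∑ k, m k = n)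
    (w : ∀ k, Fin (m k) → ℝ) : Matrix (Fin n) (Fin n) ℝ :=
  let e : (Σ k, Fin (m k)) ≃ Fin n := finSigmaFinEquiv.trans (finCongr hm)
  Matrix.reindex e e
    (blockDiagonal' fun k => vecMulVec (fun a => Real.sign (w k a)) (w k))

/-- The set `Q_IbM` of the matrices `P Y Pᵀ` in the row-scaled sign-symmetric class, with `P` a
permutation matrix and `Y` block diagonal with blocks `sign(w) wᵀ`, all entries of each `w`
being nonzero. -/
def qIbM (n : ℕ) : Set (Matrix (Fin n) (Fin n) ℝ) :=
  {X | X ∈ rowScaledSignSymm n ∧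
    ∃ (σ : Equiv.Perm (Fin n)) (K : ℕ) (m : Fin K → ℕ) (hm : ∑ k, m k = n)
      (w : ∀ k, Fin (m k) → ℝ), (∀ k a, 0 < |w k a|) ∧
      X = σ.permMatrix ℝ * signBlockMatrix m hm w * (σ.permMatrix ℝ)ᵀ}

/-- `Xs` is a locally (Lyapunov) stable fixed point of the influence-based map: every iteration
that starts close enough to `Xs` in max norm, anywhere in `ℝ^{n × n}`, is well defined at all
times (no row ever vanishes) and stays close to `Xs`. -/
def IsLocallyStableFixedPoint {n : ℕ} (Xs : Matrix (Fin n) (Fin n) ℝ) : Prop :=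
  Xs ∈ nzRow n ∧ Function.IsFixedPt ibmMap Xs ∧
    ∀ ε : ℝ, 0 < ε → ∃ δ : ℝ, 0 < δ ∧
      ∀ X₀ : Matrix (Fin n) (Fin n) ℝ, (∀ i j, |X₀ i j - Xs i j| < δ) →
        ∀ t : ℕ, ibmMap^[t] X₀ ∈ nzRow n ∧ ∀ i j, |(ibmMap^[t] X₀) i j - Xs i j| < ε

end

end SocialBalance

namespace SocialBalance

variable {n : ℕ}

/-! Entrywise, `ibmMap X i j` is a weighted mean over `k` of `sign (X i k) * X k j`, with weights
`|X i k|` normalised by row. If signs `s` make every `s i * X i j * s j` positive, these gauged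
entries undergo genuine averaging within each column. Hence convex sets of column values are
invariant (`gauge_ibmMap_mem`), which gives stability, and consensus (`exists_tendsto_of_averaging`)
gives convergence to a rank-one limit once balance holds at a single time.

Conversely, for non-vanishing appraisals the column maxima of `|X t i j|` are nonincreasing, hence
convergent. An unbalanced triad causes a cancellation that lowers one of these maxima by a fixed
amount within two steps, so it cannot occur at late times (`eventually_isBalanced_of_nonVanishing`).
The row-scaled class enters this argument through the positivity of the diagonal, which it
preserves. -/

theorem abs_rowSum_pos {X : Matrix (Fin n) (Fin n) ℝ} {i : Fin n} (h : ∃ k, X i k ≠ 0) :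
    0 < ∑ k, |X i k| := by
  obtain ⟨k, hk⟩ := h
  exact Finset.sum_pos' (fun _ _ => abs_nonneg _) ⟨k, Finset.mem_univ _, abs_pos.2 hk⟩

theorem ibmMap_apply {X : Matrix (Fin n) (Fin n) ℝ} (h : ∀ i, ∃ k, X i k ≠ 0) (i j : Fin n) :
    ibmMap X i j = (∑ k, X i k * X k j) / ∑ k, |X i k| := by
  have hv : (diagonal (X.map (fun x => |x|) *ᵥ 1))⁻¹
      = diagonal (fun i => (∑ k, |X i k|)⁻¹) := by
    refine Matrix.inv_eq_right_inv ?_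
    rw [Matrix.diagonal_mul_diagonal, ← Matrix.diagonal_one]
    congr 1
    funext i
    have := (abs_rowSum_pos (h i)).ne'
    simp only [Matrix.mulVec, dotProduct, Matrix.map_apply, Pi.one_apply, mul_one]
    exact mul_inv_cancel₀ this
  rw [ibmMap, hv, Matrix.mul_assoc, Matrix.diagonal_mul, Matrix.mul_apply, div_eq_inv_mul]

theorem ibmMap_apply_eq_weighted_sum {X : Matrix (Fin n) (Fin n) ℝ} (h : ∀ i, ∃ k, X i k ≠ 0)
    (i j : Fin n) :
    ibmMap X i j = ∑ k, (|X i k| / ∑ l, |X i l|) * (Real.sign (X i k) * X k j) := by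
  rw [ibmMap_apply h, Finset.sum_div]
  refine Finset.sum_congr rfl fun k _ => ?_
  have : Real.sign (X i k) * |X i k| = X i k := by
    rcases lt_trichotomy (X i k) 0 with h | h | h
    · rw [Real.sign_of_neg h, abs_of_neg h]; ring
    · simp [h]
    · rw [Real.sign_of_pos h, abs_of_pos h]; ring
  nth_rewrite 1 [← this]
  ring

theorem sum_weights {X : Matrix (Fin n) (Fin n) ℝ} (h : ∀ i, ∃ k, X i k ≠ 0) (i : Fin n) :
    ∑ k, (|X i k| / ∑ l, |X i l|) = 1 := by
  rw [← Finset.sum_div, div_self (abs_rowSum_pos (h i)).ne']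

/-! ### The row-scaled class is invariant -/

theorem mem_rowScaledSignSymm_iff {X : Matrix (Fin n) (Fin n) ℝ} :
    X ∈ rowScaledSignSymm n ↔
      (∀ i, 0 < X i i) ∧ ∃ γ : Fin n → ℝ, (∀ i, 0 < γ i) ∧ ∀ i j, γ i * X i j = γ j * X j i := by
  constructor
  · rintro ⟨⟨-, hd⟩, γ, hγ, hs⟩
    refine ⟨hd, γ, hγ, fun i j => ?_⟩
    have := congrFun (congrFun hs i) j
    simpa [Matrix.diagonal_mul] using this
  · rintro ⟨hd, γ, hγ, hs⟩
    refine ⟨⟨?_, hd⟩, γ, hγ, ?_⟩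
    · ext i j
      simp only [Matrix.map_apply, Matrix.transpose_apply]
      have h := hs i j
      have hi := hγ i
      have hj := hγ j
      rcases lt_trichotomy (X i j) 0 with h' | h' | h'
      · have : X j i < 0 := by
          have := mul_neg_of_pos_of_neg hi h'
          rw [h] at this
          exact (pos_iff_neg_of_mul_neg this).1 hj
        rw [Real.sign_of_neg h', Real.sign_of_neg this]
      · have : X j i = 0 := by
          rw [h', mul_zero] at h
          exact (mul_eq_zero.1 h.symm).resolve_left hj.ne'
        rw [h', this]
      · have : 0 < X j i := by
          have := mul_pos hi h'
          rw [h] at this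
          exact (pos_iff_pos_of_mul_pos this).1 hj
        rw [Real.sign_of_pos h', Real.sign_of_pos this]
    · ext i j
      simpa [Matrix.diagonal_mul] using hs i j

theorem exists_ne_zero_of_diag_pos {X : Matrix (Fin n) (Fin n) ℝ} (h : ∀ i, 0 < X i i)
    (i : Fin n) : ∃ k, X i k ≠ 0 := ⟨i, (h i).ne'⟩

/-- Multiplying `γ i` by the row sum cancels the normalisation and leaves `diag(γ) X X = Xᵀ diag(γ)
X`, which is symmetric with diagonal `∑ k, γ k * X k i ^ 2 > 0`. -/
theorem ibmMap_mem_rowScaledSignSymm {X : Matrix (Fin n) (Fin n) ℝ}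
    (hX : X ∈ rowScaledSignSymm n) : ibmMap X ∈ rowScaledSignSymm n := by
  rw [mem_rowScaledSignSymm_iff] at hX ⊢
  obtain ⟨hd, γ, hγ, hs⟩ := hX
  have hrow := exists_ne_zero_of_diag_pos hd
  have key : ∀ i j, γ i * ∑ k, X i k * X k j = ∑ k, γ k * (X k i * X k j) := by
    intro i j
    rw [Finset.mul_sum]
    refine Finset.sum_congr rfl fun k _ => ?_
    rw [← mul_assoc, hs i k, mul_assoc]
  refine ⟨fun i => ?_, fun i => γ i * ∑ k, |X i k|,
    fun i => mul_pos (hγ i) (abs_rowSum_pos (hrow i)), fun i j => ?_⟩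
  · rw [ibmMap_apply hrow]
    refine div_pos ?_ (abs_rowSum_pos (hrow i))
    have : 0 < γ i * ∑ k, X i k * X k i := by
      rw [key]
      refine Finset.sum_pos' (fun k _ => mul_nonneg (hγ k).le (mul_self_nonneg _))
        ⟨i, Finset.mem_univ _, mul_pos (hγ i) (mul_pos (hd i) (hd i))⟩
    exact (pos_iff_pos_of_mul_pos this).1 (hγ i)
  · rw [ibmMap_apply hrow, ibmMap_apply hrow, mul_assoc, mul_assoc,
      mul_div_cancel₀ _ (abs_rowSum_pos (hrow i)).ne',
      mul_div_cancel₀ _ (abs_rowSum_pos (hrow j)).ne', key, key]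
    exact Finset.sum_congr rfl fun k _ => by ring

theorem IsIbMSolution.mem {X : ℕ → Matrix (Fin n) (Fin n) ℝ} (hX : IsIbMSolution X) (t : ℕ) :
    X t ∈ rowScaledSignSymm n := by
  induction t with
  | zero => exact hX.init
  | succ t ih => rw [hX.step]; exact ibmMap_mem_rowScaledSignSymm ih

theorem IsIbMSolution.diag_pos {X : ℕ → Matrix (Fin n) (Fin n) ℝ} (hX : IsIbMSolution X) (t : ℕ)
    (i : Fin n) : 0 < X t i i := (hX.mem t).1.2 i

/-! ### Balanced matrices evolve by averaging of rows -/

section Gauge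

variable {s : Fin n → ℝ} {X : Matrix (Fin n) (Fin n) ℝ}

theorem exists_ne_zero_of_gauge_pos (h : ∀ i j, 0 < s i * X i j * s j) (i : Fin n) :
    ∃ k, X i k ≠ 0 := by
  refine ⟨i, fun h0 => ?_⟩
  have := h i i
  simp [h0] at this

theorem abs_eq_gauge (hs : ∀ i, s i * s i = 1) (h : ∀ i j, 0 < s i * X i j * s j) (i j : Fin n) :
    |X i j| = s i * X i j * s j := by
  have habs : ∀ i, |s i| = 1 := fun i => by
    have := congrArg abs (hs i)
    rw [abs_mul, abs_one] at this
    nlinarith [abs_nonneg (s i)]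
  rw [← abs_of_pos (h i j), abs_mul, abs_mul, habs, habs]
  ring

theorem gauge_ibmMap (hs : ∀ i, s i * s i = 1) (h : ∀ i j, 0 < s i * X i j * s j) (i j : Fin n) :
    s i * ibmMap X i j * s j = ∑ k, (|X i k| / ∑ l, |X i l|) * (s k * X k j * s j) := by
  rw [ibmMap_apply (exists_ne_zero_of_gauge_pos h), Finset.sum_div, Finset.mul_sum,
    Finset.sum_mul]
  refine Finset.sum_congr rfl fun k _ => ?_
  rw [abs_eq_gauge hs h i k, div_mul_eq_mul_div, mul_div_assoc', div_mul_eq_mul_div]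
  congr 1
  linear_combination (-(s i * X i k * X k j * s j)) * hs k

/-- The invariance principle behind three later uses: singletons give fixed points, balls give
stability, and a compact interval gives uniform bounds. -/
theorem gauge_ibmMap_mem (hs : ∀ i, s i * s i = 1) {C : Fin n → Set ℝ} (hC : ∀ j, Convex ℝ (C j))
    (hpos : ∀ j, C j ⊆ Set.Ioi 0) (h : ∀ i j, s i * X i j * s j ∈ C j) (i j : Fin n) :
    s i * ibmMap X i j * s j ∈ C j := by
  have h' : ∀ i j, 0 < s i * X i j * s j := fun i j => hpos j (h i j)
  rw [gauge_ibmMap hs h']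
  exact (hC j).sum_mem
    (fun k _ => div_nonneg (abs_nonneg _) (Finset.sum_nonneg fun _ _ => abs_nonneg _))
    (sum_weights (exists_ne_zero_of_gauge_pos h') i) (fun k _ => h k j)

end Gauge

/-! ### Rank-one elements of `qIbM` -/

theorem sign_mul_self_eq_abs (x : ℝ) : Real.sign x * x = |x| := by
  rcases lt_trichotomy x 0 with h | h | h
  · rw [Real.sign_of_neg h, abs_of_neg h]; ring
  · simp [h]
  · rw [Real.sign_of_pos h, abs_of_pos h]; ring

theorem sign_mul_sign_self {x : ℝ} (h : x ≠ 0) : Real.sign x * Real.sign x = 1 := by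
  rcases lt_or_gt_of_ne h with h | h
  · rw [Real.sign_of_neg h]; ring
  · rw [Real.sign_of_pos h]; ring

theorem vecMulVec_sign_mem_qIbM {u : Fin n → ℝ} (hu : ∀ i, u i ≠ 0) :
    vecMulVec (fun i => Real.sign (u i)) u ∈ qIbM n := by
  -- Identity permutation and a single block of size `n`; the row scaling is `γ i = |u i|`.
  refine ⟨?_, 1, 1, fun _ => n, by simp, fun _ => u, fun _ a => abs_pos.2 (hu a), ?_⟩
  · rw [mem_rowScaledSignSymm_iff]
    refine ⟨fun i => ?_, fun i => |u i|, fun i => abs_pos.2 (hu i), fun i j => ?_⟩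
    · rw [vecMulVec_apply, sign_mul_self_eq_abs]
      exact abs_pos.2 (hu i)
    · simp only [vecMulVec_apply, ← sign_mul_self_eq_abs]
      linear_combination u i * u j * sign_mul_sign_self (hu i)
        - u i * u j * sign_mul_sign_self (hu j)
  · have he : ∀ i : Fin n, (finSigmaFinEquiv.trans
        (finCongr (show ∑ _k : Fin 1, n = n by simp))).symm i = ⟨0, i⟩ := by
      intro i
      rw [Equiv.symm_apply_eq]
      ext
      simp [finSigmaFinEquiv_apply]
    ext i j
    rw [Matrix.permMatrix_one, Matrix.transpose_one, Matrix.one_mul, Matrix.mul_one]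
    show _ = blockDiagonal' (fun _ : Fin 1 => vecMulVec (fun a => Real.sign (u a)) u)
      ((finSigmaFinEquiv.trans (finCongr _)).symm i)
      ((finSigmaFinEquiv.trans (finCongr _)).symm j)
    rw [he, he, blockDiagonal'_apply_eq]

theorem rank_vecMulVec_sign (hn : 0 < n) {u : Fin n → ℝ} (hu : ∀ i, u i ≠ 0) :
    (vecMulVec (fun i => Real.sign (u i)) u).rank = 1 := by
  refine le_antisymm (rank_vecMulVec_le _ _) ?_
  have h := Matrix.rank_submatrix_le (vecMulVec (fun i => Real.sign (u i)) u)
    (fun _ : Fin 1 => ⟨0, hn⟩) (fun _ : Fin 1 => ⟨0, hn⟩)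
  rwa [Matrix.rank_of_det_ne_zero, Fintype.card_fin] at h
  rw [Matrix.det_fin_one, Matrix.submatrix_apply, vecMulVec_apply, sign_mul_self_eq_abs]
  exact abs_ne_zero.2 (hu _)

/-- Absorbs the permutation and the block indexing into a block label `c` and one concatenated
vector `u`. -/
theorem exists_blocks_of_mem_qIbM {X : Matrix (Fin n) (Fin n) ℝ} (hX : X ∈ qIbM n) :
    ∃ (K : ℕ) (c : Fin n → Fin K) (u : Fin n → ℝ), (∀ i, u i ≠ 0) ∧
      ∀ i j, X i j = if c i = c j then Real.sign (u i) * u j else 0 := by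
  obtain ⟨-, σ, K, m, hm, w, hw, rfl⟩ := hX
  let e : (Σ k, Fin (m k)) ≃ Fin n := finSigmaFinEquiv.trans (finCongr hm)
  have hY : ∀ a b, signBlockMatrix m hm w a b =
      if (e.symm a).1 = (e.symm b).1 then
        Real.sign (w _ (e.symm a).2) * w _ (e.symm b).2 else 0 := by
    intro a b
    show blockDiagonal' (fun k => vecMulVec (fun a => Real.sign (w k a)) (w k))
      (e.symm a) (e.symm b) = _
    generalize e.symm a = p
    generalize e.symm b = q
    obtain ⟨k, a⟩ := p
    obtain ⟨l, b⟩ := q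
    by_cases h : k = l
    · subst h
      simp [vecMulVec_apply]
    · simp [blockDiagonal'_apply_ne _ _ _ h, h]
  refine ⟨K, fun i => (e.symm (σ i)).1, fun i => w _ (e.symm (σ i)).2,
    fun i => abs_pos.1 (hw (e.symm (σ i)).1 (e.symm (σ i)).2), fun i j => ?_⟩
  rw [Matrix.transpose_permMatrix]
  simp only [Equiv.Perm.permMatrix, PEquiv.toMatrix_toPEquiv_mul, PEquiv.mul_toMatrix_toPEquiv,
    Matrix.submatrix_apply, id]
  exact hY _ _

theorem mul_eq_mul_of_rank_eq_one {X : Matrix (Fin n) (Fin n) ℝ} (h : X.rank = 1)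
    (i j : Fin n) : X i i * X j j = X i j * X j i := by
  rw [Matrix.rank_eq_finrank_span_cols] at h
  obtain ⟨v, hv⟩ := ((Submodule.finrank_le_one_iff_isPrincipal _).1 h.le).principal
  have hcol : ∀ j, ∃ c : ℝ, ∀ i, X i j = c * v i := fun j => by
    have hj : X.col j ∈ Submodule.span ℝ (Set.range X.col) :=
      Submodule.subset_span (Set.mem_range_self j)
    rw [hv, Submodule.mem_span_singleton] at hj
    obtain ⟨c, hc⟩ := hj
    exact ⟨c, fun i => (congrFun hc i).symm⟩
  choose c hc using hcol
  rw [hc i i, hc j j, hc j i, hc i j]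
  ring

/-- The vanishing 2×2 minors and the positive diagonal leave no zero entry, so all indices lie in
one block. -/
theorem exists_eq_vecMulVec_sign {X : Matrix (Fin n) (Fin n) ℝ} (hX : X ∈ qIbM n)
    (hr : X.rank = 1) :
    ∃ u : Fin n → ℝ, (∀ i, u i ≠ 0) ∧ X = vecMulVec (fun i => Real.sign (u i)) u := by
  obtain ⟨K, c, u, hu, hXu⟩ := exists_blocks_of_mem_qIbM hX
  refine ⟨u, hu, ?_⟩
  ext i j
  have h := mul_eq_mul_of_rank_eq_one hr i j
  have hi := hX.1.1.2 i
  have hj := hX.1.1.2 j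
  have hne : X i j ≠ 0 := fun h0 => by
    rw [h0, zero_mul] at h
    exact (mul_pos hi hj).ne' h
  rw [hXu i j] at hne ⊢
  by_cases hc : c i = c j
  · rw [if_pos hc, vecMulVec_apply]
  · simp [hc] at hne

/-! ### Local stability -/

theorem isLocallyStableFixedPoint_vecMulVec (hn : 0 < n) {u : Fin n → ℝ} (hu : ∀ i, u i ≠ 0) :
    IsLocallyStableFixedPoint (vecMulVec (fun i => Real.sign (u i)) u) := by
  set s : Fin n → ℝ := fun i => Real.sign (u i)
  have hs : ∀ i, s i * s i = 1 := fun i => sign_mul_sign_self (hu i)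
  have hsu : ∀ i, u i * s i = |u i| := fun i => by rw [mul_comm]; exact sign_mul_self_eq_abs _
  have hgauge : ∀ i j, s i * vecMulVec s u i j * s j = |u j| := fun i j => by
    rw [vecMulVec_apply, ← hsu j]
    linear_combination u j * s j * hs i
  have hsabs : ∀ i, |s i| = 1 := fun i => by
    have := congrArg abs (hs i)
    rw [abs_mul, abs_one] at this
    nlinarith [abs_nonneg (s i)]
  -- Conjugation by signs preserves entrywise distances, so closeness can be tested on the gauged
  -- matrix.
  have hdist : ∀ (A : Matrix (Fin n) (Fin n) ℝ) i j,
      abs (s i * A i j * s j - |u j|) = |A i j - vecMulVec s u i j| := fun A i j => by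
    rw [← hgauge i j, ← sub_mul, ← mul_sub, abs_mul, abs_mul, hsabs, hsabs]
    ring
  refine ⟨fun i h => ?_, ?_, fun ε hε => ?_⟩
  · have := congrFun h i
    simp only [Matrix.row, Pi.zero_apply, vecMulVec_apply] at this
    have h2 := sign_mul_self_eq_abs (u i)
    rw [show Real.sign (u i) = s i from rfl, this] at h2
    exact hu i (abs_eq_zero.1 h2.symm)
  · ext i j
    have h := gauge_ibmMap_mem (X := vecMulVec s u) hs (C := fun j => {|u j|})
      (fun j => convex_singleton _)
      (fun j => by simpa using hu j) hgauge i j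
    have h0 := hdist (ibmMap (vecMulVec s u)) i j
    rw [Set.mem_singleton_iff.1 h, sub_self, abs_zero] at h0
    exact sub_eq_zero.1 (abs_eq_zero.1 h0.symm)
  · have : Nonempty (Fin n) := ⟨⟨0, hn⟩⟩
    obtain ⟨j₀, hj₀⟩ := Finite.exists_min (fun j => |u j|)
    -- The bound by the least `|u j|` keeps every ball inside the positive half-line.
    refine ⟨min ε |u j₀|, lt_min hε (abs_pos.2 (hu j₀)), fun X₀ hX₀ t => ?_⟩
    set δ := min ε |u j₀|
    have hmem : ∀ i j, s i * (ibmMap^[t] X₀) i j * s j ∈ Metric.ball |u j| δ := by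
      induction t with
      | zero =>
        intro i j
        rw [Metric.mem_ball, Real.dist_eq, hdist]
        exact hX₀ i j
      | succ t ih =>
        rw [Function.iterate_succ_apply']
        refine gauge_ibmMap_mem hs (C := fun j => Metric.ball |u j| δ)
          (fun j => convex_ball _ _) (fun j x hx => ?_) ih
        rw [Metric.mem_ball, Real.dist_eq, abs_lt] at hx
        have := min_le_right ε |u j₀|
        have := hj₀ j
        exact Set.mem_Ioi.2 (by linarith [hx.1])
    have hdiff : ∀ i j, |(ibmMap^[t] X₀) i j - vecMulVec s u i j| < δ := fun i j => by
      rw [← hdist, ← Real.dist_eq]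
      exact hmem i j
    refine ⟨fun i h => ?_, fun i j => (hdiff i j).trans_le (min_le_left _ _)⟩
    have h0 : (ibmMap^[t] X₀) i i = 0 := congrFun h i
    have := hmem i i
    rw [h0, mul_zero, zero_mul, Metric.mem_ball, Real.dist_eq, zero_sub, abs_neg, abs_abs] at this
    exact absurd (this.trans_le (min_le_right _ _)) (not_lt.2 (hj₀ i))

/-! ### Consensus under averaging with uniformly positive weights -/

/-- Every new value gives weight at least `α` to the current minimum, so the spread `M t - m t` is
at most `(M t - M (t + 1)) / α`. This tends to zero because `M` is monotone and bounded. -/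
theorem exists_tendsto_of_averaging {ι : Type*} [Fintype ι] [Nonempty ι] {x : ℕ → ι → ℝ}
    {P : ℕ → ι → ι → ℝ} {α : ℝ} (hα : 0 < α) (hP : ∀ t i k, α ≤ P t i k)
    (hsum : ∀ t i, ∑ k, P t i k = 1) (hx : ∀ t i, x (t + 1) i = ∑ k, P t i k * x t k) :
    ∃ v, ∀ i, Tendsto (fun t => x t i) atTop (𝓝 v) := by
  let M : ℕ → ℝ := fun t => Finset.univ.sup' Finset.univ_nonempty (x t)
  let m : ℕ → ℝ := fun t => Finset.univ.inf' Finset.univ_nonempty (x t)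
  have hM : ∀ t i, x t i ≤ M t := fun t i => Finset.le_sup' (x t) (Finset.mem_univ i)
  have hm : ∀ t i, m t ≤ x t i := fun t i => Finset.inf'_le (x t) (Finset.mem_univ i)
  have hstepM : ∀ t, M (t + 1) ≤ M t - α * (M t - m t) := by
    intro t
    refine Finset.sup'_le _ _ fun i _ => ?_
    obtain ⟨q, -, hq⟩ := Finset.exists_mem_eq_inf' Finset.univ_nonempty (x t)
    have hq' : m t = x t q := hq
    have h1 : M t - x (t + 1) i = ∑ k, P t i k * (M t - x t k) := by
      simp only [mul_sub, Finset.sum_sub_distrib, ← Finset.sum_mul, hsum, hx, one_mul]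
    have h2 : P t i q * (M t - x t q) ≤ ∑ k, P t i k * (M t - x t k) :=
      Finset.single_le_sum (f := fun k => P t i k * (M t - x t k))
        (fun k _ => mul_nonneg (hα.le.trans (hP t i k)) (sub_nonneg.2 (hM t k)))
        (Finset.mem_univ q)
    have h3 : α * (M t - m t) ≤ P t i q * (M t - x t q) := by
      rw [hq']
      exact mul_le_mul_of_nonneg_right (hP t i q) (sub_nonneg.2 (hM t q))
    linarith
  have hstepm : ∀ t, m t ≤ m (t + 1) := by
    intro t
    refine Finset.le_inf' _ _ fun i _ => ?_
    have h1 : x (t + 1) i - m t = ∑ k, P t i k * (x t k - m t) := by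
      simp only [mul_sub, Finset.sum_sub_distrib, ← Finset.sum_mul, hsum, hx, one_mul]
    have h2 : 0 ≤ ∑ k, P t i k * (x t k - m t) := Finset.sum_nonneg fun k _ =>
      mul_nonneg (hα.le.trans (hP t i k)) (sub_nonneg.2 (hm t k))
    linarith
  have hmM : ∀ t, m t ≤ M t := fun t => (hm t (Classical.arbitrary ι)).trans (hM t _)
  have hanti : Antitone M := antitone_nat_of_succ_le fun t =>
    (hstepM t).trans (sub_le_self _ (mul_nonneg hα.le (sub_nonneg.2 (hmM t))))
  have hmono : Monotone m := monotone_nat_of_le_succ hstepm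
  have hbdd : BddBelow (Set.range M) := ⟨m 0, by
    rintro _ ⟨t, rfl⟩
    exact (hmono (Nat.zero_le t)).trans (hmM t)⟩
  have hlim := tendsto_atTop_ciInf hanti hbdd
  set v := ⨅ t, M t
  have hdiff : Tendsto (fun t => (M t - M (t + 1)) / α) atTop (𝓝 0) := by
    have := (hlim.sub (hlim.comp (tendsto_add_atTop_nat 1))).div_const α
    simpa using this
  have hlow : Tendsto m atTop (𝓝 v) := by
    have h1 : Tendsto (fun t => M t - (M t - M (t + 1)) / α) atTop (𝓝 v) := by
      simpa using hlim.sub hdiff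
    refine tendsto_of_tendsto_of_tendsto_of_le_of_le h1 hlim (fun t => ?_) hmM
    have : M t - m t ≤ (M t - M (t + 1)) / α := by
      rw [le_div_iff₀ hα]
      linarith [hstepM t]
    show M t - (M t - M (t + 1)) / α ≤ m t
    linarith
  exact ⟨v, fun i => tendsto_of_tendsto_of_tendsto_of_le_of_le hlow hlim
    (fun t => hm t i) (fun t => hM t i)⟩

/-! ### Balance implies convergence -/

theorem IsBalanced.exists_gauge (hn : 0 < n) {X : Matrix (Fin n) (Fin n) ℝ} (h : IsBalanced X) :
    ∃ s : Fin n → ℝ, (∀ i, s i * s i = 1) ∧ ∀ i j, 0 < s i * X i j * s j := by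
  have hne : ∀ i j, X i j ≠ 0 := fun i j h0 => by
    have := h.triad i j j
    simp [h0] at this
  -- Under balance, the factions can be read off from the signs of any one row.
  let o : Fin n := ⟨0, hn⟩
  refine ⟨fun i => Real.sign (X o i), fun i => sign_mul_sign_self (hne _ _), fun i j => ?_⟩
  have h1 := h.triad o i j
  have h2 := h.triad o j o
  rw [Real.sign_of_pos (h.diag_pos o), mul_one] at h2
  have hs : Real.sign (X i j) = Real.sign (X o i) * Real.sign (X o j) := by
    linear_combination Real.sign (X o i) * Real.sign (X o j) * h1
      - Real.sign (X i j) * Real.sign (X o i) * Real.sign (X o i) * h2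
      - Real.sign (X i j) * sign_mul_sign_self (hne o i)
  have : Real.sign (X o i) * X i j * Real.sign (X o j) = |X i j| := by
    rw [← sign_mul_self_eq_abs, hs]; ring
  show 0 < Real.sign (X o i) * X i j * Real.sign (X o j)
  rw [this]
  exact abs_pos.2 (hne _ _)

theorem exists_tendsto_of_isBalanced (hn : 0 < n) {X : ℕ → Matrix (Fin n) (Fin n) ℝ}
    (hX : IsIbMSolution X) {t₀ : ℕ} (h : IsBalanced (X t₀)) :
    ∃ Xs ∈ qIbM n, Xs.rank = 1 ∧ Tendsto X atTop (𝓝 Xs) := by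
  have : Nonempty (Fin n) := ⟨⟨0, hn⟩⟩
  obtain ⟨s, hs, hpos⟩ := h.exists_gauge hn
  let Z : ℕ → Fin n → Fin n → ℝ := fun t i j => s i * X (t₀ + t) i j * s j
  obtain ⟨p, hp⟩ := Finite.exists_min (fun p : Fin n × Fin n => Z 0 p.1 p.2)
  obtain ⟨q, hq⟩ := Finite.exists_max (fun p : Fin n × Fin n => Z 0 p.1 p.2)
  set a := Z 0 p.1 p.2
  set b := Z 0 q.1 q.2
  have ha : 0 < a := hpos _ _
  have hab : a ≤ b := hq p
  have hb : 0 < b := ha.trans_le hab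
  have hmem : ∀ t i j, Z t i j ∈ Set.Icc a b := by
    intro t
    induction t with
    | zero => exact fun i j => ⟨hp (i, j), hq (i, j)⟩
    | succ t ih =>
      intro i j
      show s i * X (t₀ + t + 1) i j * s j ∈ _
      rw [hX.step]
      exact gauge_ibmMap_mem hs (C := fun _ => Set.Icc a b) (fun _ => convex_Icc _ _)
        (fun _ x hx => ha.trans_le hx.1) ih i j
  have hZpos : ∀ t i j, 0 < s i * X (t₀ + t) i j * s j := fun t i j =>
    ha.trans_le (hmem t i j).1
  have habs : ∀ t i j, |X (t₀ + t) i j| = Z t i j := fun t i j => abs_eq_gauge hs (hZpos t) i j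
  have hcol : ∀ j, ∃ v, ∀ i, Tendsto (fun t => Z t i j) atTop (𝓝 v) := by
    intro j
    have hn' : (0 : ℝ) < n := Nat.cast_pos.2 hn
    -- Gauged entries stay in `[a, b]`, so each weight is at least `a` over a row sum of at most `n
    -- * b`.
    refine exists_tendsto_of_averaging (x := fun t i => Z t i j) (α := a / (n * b))
      (P := fun t i k => |X (t₀ + t) i k| / ∑ l, |X (t₀ + t) i l|) (by positivity) ?_ ?_ ?_
    · intro t i k
      refine div_le_div₀ (abs_nonneg _) ((hmem t i k).1.trans_eq (habs t i k).symm)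
        (abs_rowSum_pos (exists_ne_zero_of_gauge_pos (hZpos t) i)) ?_
      calc ∑ l, |X (t₀ + t) i l| ≤ ∑ _l : Fin n, b :=
            Finset.sum_le_sum fun l _ => (habs t i l).trans_le (hmem t i l).2
        _ = n * b := by simp
    · exact fun t i => sum_weights (exists_ne_zero_of_gauge_pos (hZpos t)) i
    · intro t i
      show s i * X (t₀ + t + 1) i j * s j = _
      rw [hX.step]
      exact gauge_ibmMap hs (hZpos t) i j
  choose v hv using hcol
  have hvpos : ∀ j, 0 < v j := fun j =>
    ha.trans_le (ge_of_tendsto' (hv j ⟨0, hn⟩) fun t => (hmem t _ j).1)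
  have hs1 : ∀ i, s i = 1 ∨ s i = -1 := fun i => mul_self_eq_one_iff.1 (hs i)
  have hu : ∀ i, s i * v i ≠ 0 := fun i h0 => by
    rcases mul_eq_zero.1 h0 with h0 | h0
    · have := hs i
      simp [h0] at this
    · exact (hvpos i).ne' h0
  have hsign : ∀ i, Real.sign (s i * v i) = s i := fun i => by
    rcases hs1 i with h | h
    · rw [h, one_mul, Real.sign_of_pos (hvpos i)]
    · rw [h, neg_one_mul, Real.sign_of_neg (neg_neg_of_pos (hvpos i))]
  refine ⟨_, vecMulVec_sign_mem_qIbM hu, rank_vecMulVec_sign hn hu, ?_⟩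
  rw [← tendsto_add_atTop_iff_nat t₀]
  refine tendsto_pi_nhds.2 fun i => tendsto_pi_nhds.2 fun j => ?_
  have h1 : Tendsto (fun t => s i * Z t i j * s j) atTop (𝓝 (s i * v j * s j)) :=
    ((hv j i).const_mul _).mul_const _
  have h2 : vecMulVec (fun i => Real.sign (s i * v i)) (fun i => s i * v i) i j
      = s i * v j * s j := by
    rw [vecMulVec_apply, hsign]; ring
  rw [h2]
  refine h1.congr fun t => ?_
  rw [add_comm t t₀]
  show s i * (s i * X (t₀ + t) i j * s j) * s j = _
  linear_combination X (t₀ + t) i j * s j * s j * hs i + X (t₀ + t) i j * hs j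

/-! ### Non-vanishing appraisals -/

theorem nonVanishing_iff {X : ℕ → Matrix (Fin n) (Fin n) ℝ} :
    NonVanishing X ↔ ∃ c : ℝ, 0 < c ∧ ∀ᶠ t in atTop, ∀ i j, c ≤ |X t i j| := by
  constructor
  · intro h
    obtain ⟨c, hc0, hc⟩ := EReal.lt_iff_exists_real_btwn.1 h
    refine ⟨c, EReal.coe_pos.1 hc0, ?_⟩
    filter_upwards [eventually_lt_of_lt_liminf hc] with t ht i j
    exact EReal.coe_le_coe_iff.1 (ht.le.trans ((iInf_le _ i).trans (iInf_le _ j)))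
  · rintro ⟨c, hc, h⟩
    refine (EReal.coe_pos.2 hc).trans_le (le_liminf_of_le (by isBoundedDefault) ?_)
    filter_upwards [h] with t ht
    exact le_iInf fun i => le_iInf fun j => EReal.coe_le_coe_iff.2 (ht i j)

theorem nonVanishing_of_tendsto (hn : 0 < n) {X : ℕ → Matrix (Fin n) (Fin n) ℝ}
    {u : Fin n → ℝ} (hu : ∀ i, u i ≠ 0)
    (h : Tendsto X atTop (𝓝 (vecMulVec (fun i => Real.sign (u i)) u))) : NonVanishing X := by
  have : Nonempty (Fin n) := ⟨⟨0, hn⟩⟩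
  obtain ⟨j₀, hj₀⟩ := Finite.exists_min (fun j => |u j|)
  have hpos : 0 < |u j₀| := abs_pos.2 (hu j₀)
  rw [nonVanishing_iff]
  refine ⟨|u j₀| / 2, half_pos hpos, ?_⟩
  rw [eventually_all]
  refine fun i => eventually_all.2 fun j => ?_
  have h1 := (tendsto_pi_nhds.1 (tendsto_pi_nhds.1 h i) j).abs
  have h2 : |vecMulVec (fun i => Real.sign (u i)) u i j| = |u j| := by
    have := congrArg abs (sign_mul_sign_self (hu i))
    rw [abs_mul, abs_one] at this
    have h3 : |Real.sign (u i)| = 1 := by nlinarith [abs_nonneg (Real.sign (u i))]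
    rw [vecMulVec_apply, abs_mul, h3, one_mul]
  rw [h2] at h1
  exact h1.eventually_const_le (by linarith [hj₀ j])

/-- The term `q` costs `2 * β` in the upper bound for the sum, and the term `p` costs as much in the
lower bound. -/
theorem abs_sum_le_sub {ι : Type*} [Fintype ι] {a : ι → ℝ} {β : ℝ} {p q : ι} (hp : β ≤ a p)
    (hq : a q ≤ -β) : |∑ k, a k| ≤ ∑ k, |a k| - 2 * β := by
  have h1 : |a q| - a q ≤ ∑ k, (|a k| - a k) :=
    Finset.single_le_sum (f := fun k => |a k| - a k) (fun k _ => sub_nonneg.2 (le_abs_self _))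
      (Finset.mem_univ q)
  have h2 : |a p| + a p ≤ ∑ k, (|a k| + a k) :=
    Finset.single_le_sum (f := fun k => |a k| + a k)
      (fun k _ => by linarith [neg_abs_le (a k)]) (Finset.mem_univ p)
  rw [Finset.sum_sub_distrib] at h1
  rw [Finset.sum_add_distrib] at h2
  rw [abs_le]
  constructor
  · linarith [le_abs_self (a p)]
  · linarith [neg_le_abs (a q)]

theorem abs_sum_le_sub_of_mul_neg {ι : Type*} [Fintype ι] {a : ι → ℝ} {β : ℝ} {p q : ι}
    (ha : ∀ k, β ≤ |a k|) (hpq : a p * a q < 0) : |∑ k, a k| ≤ ∑ k, |a k| - 2 * β := by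
  have hp := ha p
  have hq := ha q
  rcases mul_neg_iff.1 hpq with ⟨h1, h2⟩ | ⟨h1, h2⟩
  · rw [abs_of_pos h1] at hp
    rw [abs_of_neg h2] at hq
    exact abs_sum_le_sub (q := q) hp (by linarith)
  · rw [abs_of_neg h1] at hp
    rw [abs_of_pos h2] at hq
    exact abs_sum_le_sub (q := p) hq (by linarith)

theorem eventually_isBalanced_of_nonVanishing (hn : 0 < n) {X : ℕ → Matrix (Fin n) (Fin n) ℝ}
    (hX : IsIbMSolution X) (h : NonVanishing X) : ∀ᶠ t in atTop, IsBalanced (X t) := by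
  have : Nonempty (Fin n) := ⟨⟨0, hn⟩⟩
  have hn' : (0 : ℝ) < n := Nat.cast_pos.2 hn
  obtain ⟨c, hc, hev⟩ := nonVanishing_iff.1 h
  have hrow : ∀ t i, ∃ k, X t i k ≠ 0 := fun t => exists_ne_zero_of_diag_pos (hX.diag_pos t)
  let w : ℕ → Fin n → Fin n → ℝ := fun t i k => |X t i k| / ∑ l, |X t i l|
  have hw0 : ∀ t i k, 0 ≤ w t i k := fun t i k =>
    div_nonneg (abs_nonneg _) (Finset.sum_nonneg fun _ _ => abs_nonneg _)
  have hw1 : ∀ t i, ∑ k, w t i k = 1 := fun t i => sum_weights (hrow t) i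
  have hstep : ∀ t i j, X (t + 1) i j = ∑ k, w t i k * (Real.sign (X t i k) * X t k j) :=
    fun t i j => by rw [hX.step]; exact ibmMap_apply_eq_weighted_sum (hrow t) i j
  have hsgn : ∀ x : ℝ, |Real.sign x| ≤ 1 := fun x => by
    rcases Real.sign_apply_eq x with h | h | h <;> simp [h]
  have hle : ∀ t i j k,
      |w t i k * (Real.sign (X t i k) * X t k j)| ≤ w t i k * |X t k j| := fun t i j k => by
    rw [abs_mul, abs_mul, abs_of_nonneg (hw0 t i k)]
    exact mul_le_mul_of_nonneg_left
      (mul_le_of_le_one_left (abs_nonneg _) (hsgn _)) (hw0 t i k)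
  have habs : ∀ t i j, |X (t + 1) i j| ≤ ∑ k, w t i k * |X t k j| := fun t i j => by
    rw [hstep]
    exact (Finset.abs_sum_le_sum_abs _ _).trans (Finset.sum_le_sum fun k _ => hle t i j k)
  let V : ℕ → Fin n → ℝ := fun t j =>
    Finset.univ.sup' Finset.univ_nonempty (fun i => |X t i j|)
  have hV : ∀ t i j, |X t i j| ≤ V t j := fun t i j =>
    Finset.le_sup' (fun i => |X t i j|) (Finset.mem_univ i)
  have havg : ∀ t i j, ∑ k, w t i k * |X t k j| ≤ V t j := fun t i j =>
    calc ∑ k, w t i k * |X t k j| ≤ ∑ k, w t i k * V t j :=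
          Finset.sum_le_sum fun k _ => mul_le_mul_of_nonneg_left (hV t k j) (hw0 t i k)
      _ = V t j := by rw [← Finset.sum_mul, hw1, one_mul]
  have hVanti : ∀ j, Antitone (fun t => V t j) := fun j => antitone_nat_of_succ_le fun t =>
    Finset.sup'_le _ _ fun i _ => (habs t i j).trans (havg t i j)
  have hV0 : ∀ t j, 0 ≤ V t j := fun t j => (abs_nonneg _).trans (hV t ⟨0, hn⟩ j)
  obtain ⟨j₁, hj₁⟩ := Finite.exists_max (fun j => V 0 j)
  set M := V 0 j₁
  have hM : ∀ t i j, |X t i j| ≤ M := fun t i j =>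
    (hV t i j).trans ((hVanti j (Nat.zero_le t)).trans (hj₁ j))
  have hMpos : 0 < M := (abs_pos.2 (hX.diag_pos 0 ⟨0, hn⟩).ne').trans_le (hM 0 _ _)
  set α := c / (n * M)
  have hα : 0 < α := by positivity
  have hwα : ∀ t, (∀ i j, c ≤ |X t i j|) → ∀ i k, α ≤ w t i k := fun t ht i k => by
    refine div_le_div₀ (abs_nonneg _) (ht i k) (abs_rowSum_pos (hrow t i)) ?_
    calc ∑ l, |X t i l| ≤ ∑ _l : Fin n, M := Finset.sum_le_sum fun l _ => hM t i l
      _ = n * M := by simp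
  -- Two time steps: the first produces a cancellation in one entry, worth `2 * (α * c)`; the second
  -- spreads it to the whole column with weight at least `α`.
  have hdrop : ∀ j, ∀ᶠ t in atTop, V t j - V (t + 2) j < α * (2 * (α * c)) := fun j => by
    have hlim := tendsto_atTop_ciInf (hVanti j) ⟨0, by rintro _ ⟨t, rfl⟩; exact hV0 t j⟩
    have h0 : Tendsto (fun t => V t j - V (t + 2) j) atTop (𝓝 0) := by
      have := hlim.sub (hlim.comp (tendsto_add_atTop_nat 2))
      simpa using this
    exact h0.eventually_lt_const (by positivity)
  have hev1 : ∀ᶠ t in atTop, ∀ i j, c ≤ |X (t + 1) i j| :=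
    (tendsto_add_atTop_nat 1).eventually hev
  filter_upwards [hev, hev1, eventually_all.2 hdrop] with t ht ht1 hdt
  have hne : ∀ i j, X t i j ≠ 0 := fun i j => abs_pos.1 (hc.trans_le (ht i j))
  have hcons : ∀ i k j, 0 < (Real.sign (X t i k) * X t k j) * X t i j := by
    intro i k j
    by_contra hcon
    have hsk : Real.sign (X t i k) ≠ 0 := fun h0 => hne i k (Real.sign_eq_zero_iff.1 h0)
    have hlt : (Real.sign (X t i k) * X t k j) * X t i j < 0 :=
      lt_of_le_of_ne (not_lt.1 hcon) (mul_ne_zero (mul_ne_zero hsk (hne k j)) (hne i j))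
    have hwk : ∀ k, 0 < w t i k := fun k => hα.trans_le (hwα t ht i k)
    have hs1 : ∀ k, |Real.sign (X t i k)| = 1 := fun k => by
      rcases Real.sign_apply_eq_of_ne_zero _ (hne i k) with h | h <;> simp [h]
    have hX1 : |X (t + 1) i j| ≤ V t j - 2 * (α * c) := by
      -- The summand `k` is opposed by the summand `i`, which has the sign of `X t i j` because the
      -- diagonal is positive.
      have hfr := abs_sum_le_sub_of_mul_neg (β := α * c) (p := k) (q := i)
        (a := fun k => w t i k * (Real.sign (X t i k) * X t k j)) (fun k => ?_) ?_
      · rw [← hstep] at hfr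
        have := (Finset.sum_le_sum fun k (_ : k ∈ Finset.univ) => hle t i j k).trans
          (havg t i j)
        linarith
      · rw [abs_mul, abs_mul, abs_of_pos (hwk k), hs1, one_mul]
        exact mul_le_mul (hwα t ht i k) (ht k j) hc.le (hwk k).le
      · show w t i k * _ * (w t i i * (Real.sign (X t i i) * X t i j)) < 0
        rw [Real.sign_of_pos (hX.diag_pos t i)]
        have := mul_neg_of_pos_of_neg (mul_pos (hwk k) (hwk i)) hlt
        linarith
    have hV2 : V (t + 2) j ≤ V t j - α * (2 * (α * c)) := by
      refine Finset.sup'_le _ _ fun l _ => ?_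
      have h1 : V t j - ∑ k, w (t + 1) l k * |X (t + 1) k j|
          = ∑ k, w (t + 1) l k * (V t j - |X (t + 1) k j|) := by
        simp only [mul_sub, Finset.sum_sub_distrib, ← Finset.sum_mul, hw1, one_mul]
      have h2 : w (t + 1) l i * (V t j - |X (t + 1) i j|)
          ≤ ∑ k, w (t + 1) l k * (V t j - |X (t + 1) k j|) :=
        Finset.single_le_sum (f := fun k => w (t + 1) l k * (V t j - |X (t + 1) k j|))
          (fun k _ => mul_nonneg (hw0 _ _ _)
            (sub_nonneg.2 ((hV (t + 1) k j).trans (hVanti j (Nat.le_succ t)))))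
          (Finset.mem_univ i)
      have h3 : α * (2 * (α * c)) ≤ w (t + 1) l i * (V t j - |X (t + 1) i j|) :=
        mul_le_mul (hwα (t + 1) ht1 l i) (by linarith) (by positivity) (hw0 _ _ _)
      have h4 := habs (t + 1) l j
      show |X (t + 1 + 1) l j| ≤ _
      linarith
    linarith [hdt j]
  have hsign : ∀ i k j,
      Real.sign (X t i k) * Real.sign (X t k j) * Real.sign (X t i j) = 1 := by
    intro i k j
    have h1 := hcons i k j
    rcases lt_or_gt_of_ne (hne i k) with ha | ha
    · rw [Real.sign_of_neg ha, neg_one_mul, neg_mul, neg_pos] at h1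
      rcases mul_neg_iff.1 h1 with ⟨hb, hd⟩ | ⟨hb, hd⟩ <;>
        simp [Real.sign_of_neg, Real.sign_of_pos, ha, hb, hd]
    · rw [Real.sign_of_pos ha, one_mul] at h1
      rcases mul_pos_iff.1 h1 with ⟨hb, hd⟩ | ⟨hb, hd⟩ <;>
        simp [Real.sign_of_neg, Real.sign_of_pos, ha, hb, hd]
  refine ⟨hX.diag_pos t, fun i j k => ?_⟩
  have h1 := hsign i j k
  -- Taking `j = i` yields sign symmetry, which closes the triad with `X t k i` in place of `X t i
  -- k`.
  have h2 := hsign i k i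
  rw [Real.sign_of_pos (hX.diag_pos t i), mul_one] at h2
  have h3 := sign_mul_sign_self (hne i k)
  linear_combination Real.sign (X t i k) * Real.sign (X t k i) * h1
    - Real.sign (X t i j) * Real.sign (X t j k) * Real.sign (X t k i) * h3 + h2

end SocialBalance

theorem theorem4p6 (n : ℕ) (hn : 0 < n) :
    (∀ Xs ∈ SocialBalance.qIbM n, Xs.rank = 1 →
      SocialBalance.IsLocallyStableFixedPoint Xs) ∧
    (∀ X : ℕ → Matrix (Fin n) (Fin n) ℝ, SocialBalance.IsIbMSolution X →
      [SocialBalance.NonVanishing X,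
       ∃ t₀ : ℕ, ∀ t : ℕ, t₀ ≤ t → SocialBalance.IsBalanced (X t),
       ∃ Xs ∈ SocialBalance.qIbM n, Xs.rank = 1 ∧ Tendsto X atTop (𝓝 Xs)].TFAE) := by
  refine ⟨fun Xs hXs hr => ?_, fun X hX => ?_⟩
  · obtain ⟨u, hu, rfl⟩ := SocialBalance.exists_eq_vecMulVec_sign hXs hr
    exact SocialBalance.isLocallyStableFixedPoint_vecMulVec hn hu
  · tfae_have 1 → 2 := fun h =>
      eventually_atTop.1 (SocialBalance.eventually_isBalanced_of_nonVanishing hn hX h)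
    tfae_have 2 → 3 := fun ⟨t₀, h⟩ =>
      SocialBalance.exists_tendsto_of_isBalanced hn hX (h t₀ le_rfl)
    tfae_have 3 → 1 := by
      rintro ⟨Xs, hXs, hr, hlim⟩
      obtain ⟨u, hu, rfl⟩ := SocialBalance.exists_eq_vecMulVec_sign hXs hr
      exact SocialBalance.nonVanishing_of_tendsto hn hu hlim
    tfae_finish
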